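/- Let $K$ be a field of characteristic $0$ with a non-archimedean absolute value $|\cdot|$ whose residue field $k$ has characteristic $p>0$. The Gauss absolute value on $K(z)$ is $\left|\sum a_i z^i/\sum b_j z^j\right|_{\mathrm{Gauss}}=\max_i|a_i|/\max_j|b_j|$, and $|G|_{\mathrm{Gauss}}$ is the largest Gauss absolute value of an entry of a matrix $G$. Let $\Omega$ be a complete algebraically closed extension of $K$ whose (non-archimedean) absolute value extends that of $K$, containing an element $t$ which is transcendental over $K$ and such that $|\cdot|$ induces the Gauss absolute value on $K(t)$ (for instance, the completed algebraic closure of the completion of $K(t)$ for the Gauss absolute value). For a field $F$ and $G\in M_n(F(z))$ put $G_0=I_n$ and $G_{s+1}=G_sG+G_s'$, where $'$ is $d/dz$ applied entrywise. Let $G\in M_n(K(z))$ with $|G|_{\mathrm{Gauss}}\le 1$. Let $\overline G\in M_n(k(z))$ be its reduction: each entry is written $P/Q$, where $P,Q$ have coefficients in the valuation ring and $Q$ does not reduce to $0$, and $P$, $Q$ are reduced coefficientwise. Let $R\in[0,+\infty]$ be the generic radius of convergence of $y'=Gy$, that is, the radius of convergence of the matrix power series $$\mathcal U(z)=\sum_{s\ge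 0}\frac{G_s(t)}{s!}(z-t)^s$$ over $\Omega$ (the solution of $y'=Gy$ with $\mathcal U(t)=I_n$). Let $\pi\in\Omega$ satisfy $\pi^{p-1}=-p$. Then the system $y'=\overline Gy$ is nilpotent, i.e. the matrix $\overline G_p$ of index $p$ in the sequence attached to $\overline G$ is nilpotent, if and only if $R>|\pi|$. Moreover $|\pi|=|p|^{1/(p-1)}$, which equals $p^{-1/(p-1)}$ when the absolute value is normalized by $|p|=1/p$. -/

import Mathlib

open scoped Nat

universe u

namespace GenericRadius

open Polynomial

noncomputable section

/-! ### Derivation of rational functions and the matrices `G_s` -/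

/-- The usual derivative `d/dz` on `F(z)`, for a field `F` of any characteristic. -/
def ratDeriv {F : Type*} [Field F] (f : RatFunc F) : RatFunc F :=
  algebraMap F[X] (RatFunc F)
      (derivative f.num * f.denom - f.num * derivative f.denom) /
    algebraMap F[X] (RatFunc F) (f.denom ^ 2)

/-- The quotient rule holds for every way of writing a rational function as a fraction. -/
theorem ratDeriv_div {F : Type*} [Field F] (P Q : F[X]) (hQ : Q ≠ 0) :
    ratDeriv (algebraMap F[X] (RatFunc F) P / algebraMap F[X] (RatFunc F) Q) =
      algebraMap F[X] (RatFunc F) (derivative P * Q - P * derivative Q) /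
        algebraMap F[X] (RatFunc F) (Q ^ 2) := by
  set f : RatFunc F := algebraMap F[X] (RatFunc F) P / algebraMap F[X] (RatFunc F) Q with hf
  have hd : f.denom ≠ 0 := f.denom_ne_zero
  have hinj := RatFunc.algebraMap_injective F
  have hQ' : algebraMap F[X] (RatFunc F) Q ≠ 0 := RatFunc.algebraMap_ne_zero hQ
  have hd' : algebraMap F[X] (RatFunc F) f.denom ≠ 0 := RatFunc.algebraMap_ne_zero hd
  have h1 : f.num * Q = P * f.denom := by
    apply hinj
    rw [map_mul, map_mul, ← div_eq_div_iff hd' hQ', RatFunc.num_div_denom f]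
  have h2 : derivative f.num * Q + f.num * derivative Q =
      derivative P * f.denom + P * derivative f.denom := by
    simpa only [derivative_mul] using congrArg derivative h1
  unfold ratDeriv
  rw [div_eq_div_iff (RatFunc.algebraMap_ne_zero (pow_ne_zero 2 hd))
    (RatFunc.algebraMap_ne_zero (pow_ne_zero 2 hQ)), ← map_mul, ← map_mul]
  congr 1
  linear_combination (Q * f.denom) * h2 - (derivative Q * f.denom + Q * derivative f.denom) * h1

/-- The sequence `G_0 = 1`, `G_{s+1} = G_s G + G_s'` attached to the system `y' = G y`: every
solution satisfies `y^{(s)} = G_s y`. -/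
def iterMatrix {F : Type*} [Field F] {n : ℕ} (G : Matrix (Fin n) (Fin n) (RatFunc F)) :
    ℕ → Matrix (Fin n) (Fin n) (RatFunc F)
  | 0 => 1
  | s + 1 => iterMatrix G s * G + (iterMatrix G s).map ratDeriv

/-- In characteristic `p`, the system `y' = G y` is nilpotent if the matrix `G_p` is nilpotent. -/
def IsNilpotentSystem {F : Type*} [Field F] (p : ℕ) [CharP F p] {n : ℕ}
    (G : Matrix (Fin n) (Fin n) (RatFunc F)) : Prop :=
  IsNilpotent (iterMatrix G p)

/-! ### Gauss absolute value and reduction -/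

section Gauss

variable {K : Type*} [NormedField K]

/-- The Gauss absolute value on `K(z)`: the quotient of the largest absolute value of a coefficient
of the numerator by that of the denominator. -/
def ratGaussNorm (f : RatFunc K) : ℝ := f.num.supNorm / f.denom.supNorm

/-- The Gauss norm of a matrix: the supremum of the Gauss absolute values of its entries. -/
def matrixGaussNorm {n : ℕ} (G : Matrix (Fin n) (Fin n) (RatFunc K)) : ℝ :=
  ⨆ ij : Fin n × Fin n, ratGaussNorm (G ij.1 ij.2)

end Gauss

section Reduction

variable (K : Type*) [NormedField K] [IsUltrametricDist K]

/-- The valuation ring of `K`. -/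
abbrev valRing : ValuationSubring K := (NormedField.valuation (K := K)).valuationSubring

/-- The residue field of `K`. -/
abbrev residueField : Type _ := IsLocalRing.ResidueField (valRing K)

variable {K}

theorem supNorm_mul (P Q : K[X]) : (P * Q).supNorm = P.supNorm * Q.supNorm := by
  have hna : IsNonarchimedean (NormedField.toAbsoluteValue K) :=
    fun x y => IsUltrametricDist.norm_add_le_max x y
  exact gaussNorm_mul hna one_pos P Q

/-- The Gauss absolute value may be computed on every fraction that represents the function. -/
theorem ratGaussNorm_div (P Q : K[X]) (hQ : Q ≠ 0) :
    ratGaussNorm (algebraMap K[X] (RatFunc K) P / algebraMap K[X] (RatFunc K) Q) =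
      P.supNorm / Q.supNorm := by
  set f : RatFunc K := algebraMap K[X] (RatFunc K) P / algebraMap K[X] (RatFunc K) Q with hf
  have hd : f.denom ≠ 0 := f.denom_ne_zero
  have hQ' : algebraMap K[X] (RatFunc K) Q ≠ 0 := RatFunc.algebraMap_ne_zero hQ
  have hd' : algebraMap K[X] (RatFunc K) f.denom ≠ 0 := RatFunc.algebraMap_ne_zero hd
  have h1 : f.num * Q = P * f.denom := by
    apply RatFunc.algebraMap_injective K
    rw [map_mul, map_mul, ← div_eq_div_iff hd' hQ', RatFunc.num_div_denom f]
  have h2 := congrArg Polynomial.supNorm h1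
  rw [supNorm_mul, supNorm_mul] at h2
  unfold ratGaussNorm
  rw [div_eq_div_iff (mt (supNorm_eq_zero_iff _).mp hd) (mt (supNorm_eq_zero_iff _).mp hQ)]
  exact h2

/-- `P / Q`, where `P` and `Q` have coefficients in the valuation ring and `Q` is nonzero modulo the
maximal ideal, represents the rational function `f`. -/
def Represents (f : RatFunc K) (P Q : (valRing K)[X]) : Prop :=
  Q.map (IsLocalRing.residue (valRing K)) ≠ 0 ∧
    f = algebraMap K[X] (RatFunc K) (P.map (valRing K).subtype) /
      algebraMap K[X] (RatFunc K) (Q.map (valRing K).subtype)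

/-- The fraction `P / Q` reduced coefficient by coefficient. -/
def reducedFraction (P Q : (valRing K)[X]) : RatFunc (residueField K) :=
  algebraMap (residueField K)[X] (RatFunc (residueField K))
      (P.map (IsLocalRing.residue (valRing K))) /
    algebraMap (residueField K)[X] (RatFunc (residueField K))
      (Q.map (IsLocalRing.residue (valRing K)))

theorem Represents.reducedFraction_eq {f : RatFunc K} {P Q P' Q' : (valRing K)[X]}
    (h : Represents f P Q) (h' : Represents f P' Q') :
    reducedFraction P Q = reducedFraction P' Q' := by
  have hinj : Function.Injective (valRing K).subtype := Subtype.val_injective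
  have aux : ∀ {R : (valRing K)[X]}, R.map (IsLocalRing.residue (valRing K)) ≠ 0 →
      algebraMap K[X] (RatFunc K) (R.map (valRing K).subtype) ≠ 0 := by
    intro R hR
    apply RatFunc.algebraMap_ne_zero
    rw [Ne, Polynomial.map_eq_zero_iff hinj]
    rintro rfl
    exact hR (Polynomial.map_zero _)
  have h1 := h.2.symm.trans h'.2
  rw [div_eq_div_iff (aux h.1) (aux h'.1), ← map_mul, ← map_mul] at h1
  have h2 := RatFunc.algebraMap_injective K h1
  rw [← Polynomial.map_mul, ← Polynomial.map_mul] at h2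
  have h3 := congrArg (Polynomial.map (IsLocalRing.residue (valRing K)))
    (Polynomial.map_injective _ hinj h2)
  rw [Polynomial.map_mul, Polynomial.map_mul] at h3
  unfold reducedFraction
  rw [div_eq_div_iff (RatFunc.algebraMap_ne_zero h.1) (RatFunc.algebraMap_ne_zero h'.1),
    ← map_mul, ← map_mul, h3]

theorem exists_represents {f : RatFunc K} (hf : ratGaussNorm f ≤ 1) :
    ∃ P Q : (valRing K)[X], Represents f P Q := by
  have hd : f.denom ≠ 0 := f.denom_ne_zero
  obtain ⟨i, hi⟩ := f.denom.exists_eq_supNorm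
  have hpos : 0 < f.denom.supNorm := lt_of_le_of_ne f.denom.supNorm_nonneg
    (Ne.symm (mt (supNorm_eq_zero_iff _).mp hd))
  set c := f.denom.coeff i with hc
  have hc0 : c ≠ 0 := by
    intro h
    rw [h, norm_zero] at hi
    exact hpos.ne' hi
  have hnum : f.num.supNorm ≤ f.denom.supNorm := (div_le_one hpos).mp hf
  have key : ∀ R : K[X], R.supNorm ≤ ‖c‖ →
      ∃ S : (valRing K)[X], S.map (valRing K).subtype = C c⁻¹ * R := by
    intro R hR
    have : C c⁻¹ * R ∈ Polynomial.lifts (valRing K).subtype := by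
      rw [Polynomial.lifts_iff_coeff_lifts]
      intro k
      refine ⟨⟨(C c⁻¹ * R).coeff k, ?_⟩, rfl⟩
      rw [Valuation.mem_valuationSubring_iff, NormedField.valuation_apply, ← NNReal.coe_le_coe,
        coe_nnnorm, coeff_C_mul, norm_mul, norm_inv, NNReal.coe_one,
        inv_mul_le_one₀ (norm_pos_iff.mpr hc0)]
      exact (R.le_supNorm k).trans hR
    exact (Polynomial.mem_lifts _).mp this
  obtain ⟨P, hP⟩ := key f.num (hnum.trans hi.le)
  obtain ⟨Q, hQ⟩ := key f.denom hi.le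
  refine ⟨P, Q, ?_, ?_⟩
  · intro h0
    have h1 : Q.coeff i = 1 := by
      apply Subtype.val_injective
      have := congrArg (fun R : K[X] => R.coeff i) hQ
      simp only [coeff_map, coeff_C_mul, ← hc, inv_mul_cancel₀ hc0] at this
      exact this
    have h2 := congrArg (fun R => R.coeff i) h0
    simp only [coeff_map, h1, map_one, coeff_zero] at h2
    exact one_ne_zero h2
  · have hC : algebraMap K[X] (RatFunc K) (C c⁻¹) ≠ 0 :=
      RatFunc.algebraMap_ne_zero (by simpa using hc0)
    rw [hP, hQ, map_mul, map_mul, mul_div_mul_left _ _ hC, RatFunc.num_div_denom]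

open Classical in
/-- Reduction modulo the maximal ideal, from `{f ∈ K(z) : |f|_Gauss ≤ 1}` to `k(z)`, where `k` is the
residue field: write `f = P / Q` with `P`, `Q` integral and `Q` nonzero modulo the maximal ideal,
and reduce `P` and `Q` coefficient by coefficient (and the value is `0` if `|f|_Gauss > 1`). -/
def ratReduction (f : RatFunc K) : RatFunc (residueField K) :=
  if h : ∃ P Q : (valRing K)[X], Represents f P Q then
    reducedFraction h.choose h.choose_spec.choose
  else 0

/-- The reduction does not depend on the fraction chosen. -/
theorem ratReduction_eq {f : RatFunc K} {P Q : (valRing K)[X]} (h : Represents f P Q) :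
    ratReduction f = reducedFraction P Q := by
  have h' : ∃ P Q : (valRing K)[X], Represents f P Q := ⟨P, Q, h⟩
  rw [ratReduction, dif_pos h']
  exact h'.choose_spec.choose_spec.reducedFraction_eq h

/-- The reduced matrix, entry by entry. -/
def matrixReduction {n : ℕ} (G : Matrix (Fin n) (Fin n) (RatFunc K)) :
    Matrix (Fin n) (Fin n) (RatFunc (residueField K)) :=
  G.map ratReduction

end Reduction

/-! ### Generic point and generic radius of convergence -/

section Generic

variable {K : Type*} [NormedField K] {Ω : Type*} [NontriviallyNormedField Ω] [NormedAlgebra K Ω]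

/-- The value `f(t)` of a rational function `f ∈ K(z)` at a point `t ∈ Ω` that is not a pole of `f`
(no point transcendental over `K` is a pole). -/
def ratEval (t : Ω) (f : RatFunc K) : Ω := aeval t f.num / aeval t f.denom

/-- `t ∈ Ω` is a generic point over `K`: it is transcendental over `K` and the absolute value of `Ω`
induces on `K(t)` the Gauss absolute value. -/
def IsGenericPoint (K : Type*) [NormedField K] {Ω : Type*} [NontriviallyNormedField Ω]
    [NormedAlgebra K Ω] (t : Ω) : Prop :=
  Transcendental K t ∧
    ∀ f : RatFunc K, ‖ratEval t f‖ = ratGaussNorm f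

/-- The entries of the solution `U = ∑ (G_s(t) / s!) (z - t)^s` of `y' = G y` with `U(t) = 1`, as
power series in `X = z - t`. -/
def genericSolution {n : ℕ} (G : Matrix (Fin n) (Fin n) (RatFunc K)) (t : Ω) :
    Matrix (Fin n) (Fin n) (PowerSeries Ω) :=
  Matrix.of fun i j => PowerSeries.mk fun s =>
    ratEval t (iterMatrix G s i j) / (s ! : Ω)

/-- The radius of convergence of a power series over `Ω`. -/
def seriesRadius (f : PowerSeries Ω) : ENNReal :=
  (FormalMultilinearSeries.ofScalars Ω fun s => PowerSeries.coeff s f).radius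

/-- The generic radius of convergence of `y' = G y`: the radius of convergence of the matrix series
`U`, that is, the least radius of convergence of its entries. -/
def genericRadius {n : ℕ} (G : Matrix (Fin n) (Fin n) (RatFunc K)) (t : Ω) : ENNReal :=
  ⨅ i, ⨅ j, seriesRadius (genericSolution G t i j)

end Generic

/-! ### Existence of the field `Ω` -/

section Existence

variable (K : Type*) [NormedField K]

theorem ratGaussNorm_zero : ratGaussNorm (0 : RatFunc K) = 0 := by
  simp [ratGaussNorm]

theorem exists_frac (f : RatFunc K) : ∃ P Q : K[X], Q ≠ 0 ∧ f = algebraMap K[X] (RatFunc K) P / algebraMap K[X] (RatFunc K) Q :=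
  ⟨f.num, f.denom, f.denom_ne_zero, (f.num_div_denom).symm⟩

theorem ratGaussNorm_nonneg (f : RatFunc K) : 0 ≤ ratGaussNorm f := div_nonneg (supNorm_nonneg _) (supNorm_nonneg _)

theorem ratGaussNorm_eq_zero {f : RatFunc K} (h : ratGaussNorm f = 0) : f = 0 := by
  unfold ratGaussNorm at h
  rcases div_eq_zero_iff.mp h with h | h
  · exact RatFunc.num_eq_zero_iff.mp ((supNorm_eq_zero_iff _).mp h)
  · exact absurd ((supNorm_eq_zero_iff _).mp h) f.denom_ne_zero

variable [IsUltrametricDist K]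

theorem ratGaussNorm_mul (f g : RatFunc K) : ratGaussNorm (f * g) = ratGaussNorm f * ratGaussNorm g := by
  obtain ⟨P, Q, hQ, rfl⟩ := exists_frac K f
  obtain ⟨R, S, hS, rfl⟩ := exists_frac K g
  rw [div_mul_div_comm, ← map_mul, ← map_mul, ratGaussNorm_div _ _ (mul_ne_zero hQ hS),
    ratGaussNorm_div _ _ hQ, ratGaussNorm_div _ _ hS, supNorm_mul, supNorm_mul, div_mul_div_comm]

theorem supNorm_add (P Q : K[X]) : (P + Q).supNorm ≤ max P.supNorm Q.supNorm := by
  obtain ⟨i, hi⟩ := (P+Q).exists_eq_supNorm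
  rw [hi, coeff_add]
  exact (IsUltrametricDist.norm_add_le_max _ _).trans (max_le_max (P.le_supNorm i) (Q.le_supNorm i))

theorem ratGaussNorm_add (f g : RatFunc K) : ratGaussNorm (f + g) ≤ max (ratGaussNorm f) (ratGaussNorm g) := by
  obtain ⟨P, Q, hQ, rfl⟩ := exists_frac K f
  obtain ⟨R, S, hS, rfl⟩ := exists_frac K g
  have q0 : 0 < Q.supNorm := lt_of_le_of_ne Q.supNorm_nonneg (Ne.symm (mt (supNorm_eq_zero_iff _).mp hQ))
  have s0 : 0 < S.supNorm := lt_of_le_of_ne S.supNorm_nonneg (Ne.symm (mt (supNorm_eq_zero_iff _).mp hS))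
  rw [div_add_div _ _ (RatFunc.algebraMap_ne_zero hQ) (RatFunc.algebraMap_ne_zero hS), ← map_mul, ← map_mul, ← map_mul, ← map_add, ratGaussNorm_div _ _ (mul_ne_zero hQ hS),
    ratGaussNorm_div _ _ hQ, ratGaussNorm_div _ _ hS]
  rw [supNorm_mul, div_le_iff₀ (mul_pos q0 s0)]
  refine (supNorm_add K _ _).trans ?_
  rw [supNorm_mul, supNorm_mul]
  rw [max_mul_of_nonneg _ _ (mul_pos q0 s0).le]
  apply le_of_eq
  congr 1 <;> field_simp

theorem ratGaussNorm_neg (f : RatFunc K) : ratGaussNorm (-f) = ratGaussNorm f := by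
  have h1 : ratGaussNorm (-1 : RatFunc K) = 1 := by
    have := ratGaussNorm_div (K := K) (C (-1)) (C 1) (by simp)
    rw [supNorm_C, supNorm_C] at this
    simpa using this
  rw [neg_eq_neg_one_mul, ratGaussNorm_mul, h1, one_mul]

/-- `K(z)` with the Gauss absolute value. -/
abbrev gaussField : NormedField (RatFunc K) :=
  { (inferInstance : Field (RatFunc K)) with
    norm x := ratGaussNorm x
    dist x y := ratGaussNorm (x - y)
    dist_self x := by simp [ratGaussNorm_zero]
    dist_comm x y := by rw [← neg_sub, ratGaussNorm_neg]
    dist_triangle x y z := by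
      rw [← sub_add_sub_cancel x y z]
      exact (ratGaussNorm_add K _ _).trans (max_le_add_of_nonneg (ratGaussNorm_nonneg K _) (ratGaussNorm_nonneg K _))
    eq_of_dist_eq_zero hxy := sub_eq_zero.mp (ratGaussNorm_eq_zero K hxy)
    dist_eq x y := by rw [← ratGaussNorm_neg]; congr 1; ring
    norm_mul x y := ratGaussNorm_mul K x y
    edist_dist x y := by rw [ENNReal.ofReal_eq_coe_nnreal] }

end Existence

theorem exists_algClosed_of_complete (F : Type u) [NontriviallyNormedField F] [IsUltrametricDist F] [CompleteSpace F] [CharZero F] :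
  ∃ (Ω : Type u) (_ : NontriviallyNormedField Ω) (_ : NormedAlgebra F Ω),
    IsUltrametricDist Ω ∧ CompleteSpace Ω ∧ IsAlgClosed Ω := by
  let i1 : NontriviallyNormedField (AlgebraicClosure F) := spectralNorm.nontriviallyNormedField F _
  let i2 : NormedAlgebra F (AlgebraicClosure F) := spectralNorm.normedAlgebra F _
  have : IsUltrametricDist (AlgebraicClosure F) := IsUltrametricDist.of_normedAlgebra F
  let i3 : NontriviallyNormedField (UniformSpace.Completion (AlgebraicClosure F)) :=
    { (inferInstance : NormedField (UniformSpace.Completion (AlgebraicClosure F))) with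
    non_trivial := by
      obtain ⟨x, hx⟩ := NontriviallyNormedField.non_trivial (α := AlgebraicClosure F)
      exact ⟨(x : UniformSpace.Completion (AlgebraicClosure F)), by rw [UniformSpace.Completion.norm_coe]; exact hx⟩ }
  let i4 : NormedAlgebra F (UniformSpace.Completion (AlgebraicClosure F)) := inferInstance
  have : IsUltrametricDist (UniformSpace.Completion (AlgebraicClosure F)) := IsUltrametricDist.of_normedAlgebra F
  have : CharZero (UniformSpace.Completion (AlgebraicClosure F)) := (RingHom.charZero_iff (algebraMap F _).injective).mp inferInstance
  refine ⟨UniformSpace.Completion (AlgebraicClosure F), i3, i4, inferInstance, inferInstance, ?_⟩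
  exact IsAlgClosed.of_denseRange (K := AlgebraicClosure F) UniformSpace.Completion.denseRange_coe

theorem exists_algClosed (F : Type u) [NontriviallyNormedField F] [IsUltrametricDist F] [CharZero F] :
  ∃ (Ω : Type u) (_ : NontriviallyNormedField Ω) (_ : NormedAlgebra F Ω),
    IsUltrametricDist Ω ∧ CompleteSpace Ω ∧ IsAlgClosed Ω := by
  let i3 : NontriviallyNormedField (UniformSpace.Completion F) :=
    { (inferInstance : NormedField (UniformSpace.Completion F)) with
    non_trivial := by
      obtain ⟨x, hx⟩ := NontriviallyNormedField.non_trivial (α := F)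
      exact ⟨(x : UniformSpace.Completion F), by rw [UniformSpace.Completion.norm_coe]; exact hx⟩ }
  have : IsUltrametricDist (UniformSpace.Completion F) := IsUltrametricDist.of_normedAlgebra F
  have : CharZero (UniformSpace.Completion F) := (RingHom.charZero_iff (algebraMap F _).injective).mp inferInstance
  obtain ⟨Ω, i, j, a, b, c⟩ := exists_algClosed_of_complete (UniformSpace.Completion F)
  let alg : Algebra F Ω := ((algebraMap (UniformSpace.Completion F) Ω).comp (algebraMap F (UniformSpace.Completion F))).toAlgebra
  refine ⟨Ω, i, { alg with norm_smul_le := fun r x => ?_ }, a, b, c⟩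
  rw [Algebra.smul_def, norm_mul]
  apply le_of_eq
  congr 1
  show ‖algebraMap (UniformSpace.Completion F) Ω (algebraMap F (UniformSpace.Completion F) r)‖ = _
  rw [norm_algebraMap', norm_algebraMap']

/-- A complete algebraically closed extension of `K` containing a generic point exists: the completed
algebraic closure of the completion of `K(t)`, with the Gauss absolute value. -/
theorem exists_genericPoint (K : Type u) [NontriviallyNormedField K] [IsUltrametricDist K] [CharZero K] :
  ∃ (Ω : Type u) (_ : NontriviallyNormedField Ω) (_ : NormedAlgebra K Ω),
    IsUltrametricDist Ω ∧ CompleteSpace Ω ∧ IsAlgClosed Ω ∧ ∃ t : Ω, IsGenericPoint K t := by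
  have hC : ∀ x : K, ratGaussNorm (algebraMap K (RatFunc K) x) = ‖x‖ := by
    intro x
    have := ratGaussNorm_div (K := K) (C x) (C 1) (by simp)
    rw [supNorm_C, supNorm_C] at this
    simp only [map_one, div_one, norm_one] at this
    exact this
  let : NontriviallyNormedField (RatFunc K) := { gaussField K with
    non_trivial := by
      obtain ⟨x, hx⟩ := NontriviallyNormedField.non_trivial (α := K)
      exact ⟨algebraMap K _ x, by rw [← hC] at hx; exact hx⟩ }
  have : IsUltrametricDist (RatFunc K) := IsUltrametricDist.isUltrametricDist_of_forall_norm_add_le_max_norm (ratGaussNorm_add K)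
  have : CharZero (RatFunc K) := (RingHom.charZero_iff (algebraMap K _).injective).mp inferInstance
  obtain ⟨Ω, i, j, a, b, c⟩ := exists_algClosed (RatFunc K)
  let ψ : RatFunc K →+* Ω := algebraMap _ _
  have hψ : ∀ f, ‖ψ f‖ = ratGaussNorm f := fun f => norm_algebraMap' Ω f
  let alg : Algebra K Ω := (ψ.comp (algebraMap K (RatFunc K))).toAlgebra
  let nalg : NormedAlgebra K Ω := { alg with
    norm_smul_le := fun r x => by
      rw [Algebra.smul_def, norm_mul]
      apply le_of_eq
      congr 1
      exact (hψ _).trans (hC r) }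
  have hev : ∀ P : K[X], aeval (ψ RatFunc.X) P = ψ (algebraMap K[X] (RatFunc K) P) := by
    intro P
    have : (eval₂RingHom (algebraMap K Ω) (ψ RatFunc.X)) = ψ.comp (algebraMap K[X] (RatFunc K)) := by
      apply Polynomial.ringHom_ext
      · intro a
        simp; rfl
      · simp
    exact congrArg (fun h => h P) this
  refine ⟨Ω, i, nalg, a, b, c, ψ RatFunc.X, ?_, ?_⟩
  · rw [transcendental_iff]
    intro P hP
    rw [hev, map_eq_zero] at hP
    exact (map_eq_zero_iff _ (RatFunc.algebraMap_injective K)).mp hP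
  · intro f
    rw [← hψ, ratEval, hev, hev, ← map_div₀, RatFunc.num_div_denom]

end

end GenericRadius

/-!
Put `∇ M = M G + M'`, so that `G_s = ∇^s 1`. In characteristic `p` the Leibniz rule for `∇^p` and the
vanishing of `(d/dz)^p` make `∇^p` linear, whence `G_{pk} = G_p^k`; so the reduced system is nilpotent
if and only if `|G_{pk}| < 1` for some `k > 0`. Assume this and put `N = pk`. In
`∇^N M = ∑ (N choose i) M^(i) G_{N-i}` the bound `|M^(i) / i!| ≤ |M|`, valid for the Gauss norm, makes
every term with `i > 0` divisible by `N`, so `∇^N` is a contraction, `|G_s|` decays geometrically, and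
as `|s!| ≥ |π|^s` the radius exceeds `|π|`. Conversely `|s!| = |π|^(s-1)` for `s = p^k`, so convergence
beyond `|π|` forces `|G_{p^k}|` to tend to `0`.
-/

namespace GenericRadius

open Polynomial Filter Topology
open Finset.HasAntidiagonal (antidiagonal mem_antidiagonal)

noncomputable section

section Connection

variable {A : Type*} [Ring A]

/-- `D` satisfies the Leibniz rule along `d`, as a connection on the left module `A` over the
differential ring `(A, d)` does; for `D = d` this says that `d` is a derivation. -/
def IsDerivationAlong (d D : A →+ A) : Prop := ∀ a b, D (a * b) = d a * b + a * D b

theorem IsDerivationAlong.iterate_mul {d D : A →+ A} (h : IsDerivationAlong d D) (a b : A)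
    (N : ℕ) :
    D^[N] (a * b) =
      ∑ ij ∈ antidiagonal N, N.choose ij.1 • (d^[ij.1] a * D^[ij.2] b) := by
  induction N with
  | zero => simp
  | succ N ih =>
    rw [Finset.sum_antidiagonal_choose_succ_nsmul (fun i j => d^[i] a * D^[j] b),
      Function.iterate_succ_apply', ih, map_sum, ← Finset.sum_add_distrib]
    refine Finset.sum_congr rfl fun ij hij => ?_
    rw [map_nsmul, h, nsmul_add, ← Function.iterate_succ_apply' d, ← Function.iterate_succ_apply' D,
      add_comm, Nat.choose_symm_of_eq_add (mem_antidiagonal.mp hij).symm]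

theorem IsDerivationAlong.iterate_prime_mul {d D : A →+ A} (h : IsDerivationAlong d D) {p : ℕ}
    (hp : p.Prime) (hpA : (p : A) = 0) (a b : A) :
    D^[p] (a * b) = d^[p] a * b + a * D^[p] b := by
  have choose_smul_eq_zero {i : ℕ} (hi : i ≠ 0) (hip : i < p) (c : A) : p.choose i • c = 0 := by
    obtain ⟨m, hm⟩ := hp.dvd_choose_self hi hip
    rw [hm, nsmul_eq_mul, Nat.cast_mul, hpA, zero_mul, zero_mul]
  rw [h.iterate_mul, Finset.sum_eq_add (p, 0) (0, p) (by simp [hp.ne_zero])]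
  · simp
  · rintro ⟨i, j⟩ hij ⟨hi, hj⟩
    have hij : i + j = p := mem_antidiagonal.mp hij
    exact choose_smul_eq_zero (by grind) (by grind) _
  · simp
  · simp

/-- The connection `a ↦ a G + d a`, whose iterates at `1` are the matrices `G_s` of the system
`y' = G y` when `A` is a matrix ring and `d` is entrywise differentiation. -/
def connection (d : A →+ A) (G : A) : A →+ A := AddMonoidHom.mulRight G + d

theorem connection_apply (d : A →+ A) (G a : A) : connection d G a = a * G + d a := rfl

theorem isDerivationAlong_connection {d : A →+ A} (hd : IsDerivationAlong d d) (G : A) :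
    IsDerivationAlong d (connection d G) := fun a b => by
  rw [connection_apply, connection_apply, hd, mul_add, mul_assoc]
  abel

/-- By the Leibniz rule in characteristic `p`, the iterate `∇^p` is linear when `d^p = 0`. -/
theorem connection_iterate_prime_mul_one {d : A →+ A} (hd : IsDerivationAlong d d) (G : A)
    {p : ℕ} (hp : p.Prime) (hpA : (p : A) = 0) (hdp : ∀ a, d^[p] a = 0) (k : ℕ) :
    (connection d G)^[p * k] 1 = ((connection d G)^[p] 1) ^ k := by
  induction k with
  | zero => simp
  | succ k ih =>
    rw [mul_add_one, add_comm, Function.iterate_add_apply, ih]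
    conv_lhs => rw [← mul_one (_ ^ k)]
    rw [(isDerivationAlong_connection hd G).iterate_prime_mul hp hpA, hdp, zero_mul, zero_add,
      pow_succ]

end Connection

section TaylorBound

variable {K : Type*} [NormedField K]

theorem norm_nsmul_eq_natCast {A : Type*} [SeminormedAddCommGroup A] [NormedSpace K A] (m : ℕ)
    (a : A) : ‖m • a‖ = ‖(m : K)‖ * ‖a‖ := by
  rw [← Nat.cast_smul_eq_nsmul K, norm_smul]

variable {A : Type*} [SeminormedRing A]

variable (K) in
/-- The bound `|d^k a / k!| ≤ |a|` for all `k`, multiplied by `|k!|` so that no division is needed: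
for `d = d/dz` it bounds the Taylor coefficients of `a` at a generic point. -/
def IsTaylorBounded (d : A →+ A) (a : A) : Prop := ∀ k, ‖d^[k] a‖ ≤ ‖(k ! : K)‖ * ‖a‖

theorem IsTaylorBounded.norm_apply_le {d : A →+ A} {a : A} (h : IsTaylorBounded K d a) :
    ‖d a‖ ≤ ‖a‖ := by
  simpa using h 1

theorem IsTaylorBounded.norm_choose_nsmul_mul_le [NormedAlgebra K A] {d : A →+ A} {a : A}
    (ha : IsTaylorBounded K d a) (b : A) (N k : ℕ) :
    ‖N.choose k • (d^[k] a * b)‖ ≤ ‖((N.choose k * k ! : ℕ) : K)‖ * (‖a‖ * ‖b‖) :=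
  calc ‖N.choose k • (d^[k] a * b)‖ = ‖(N.choose k : K)‖ * ‖d^[k] a * b‖ :=
        norm_nsmul_eq_natCast _ _
    _ ≤ ‖(N.choose k : K)‖ * (‖(k ! : K)‖ * ‖a‖ * ‖b‖) := by
        gcongr
        exact (norm_mul_le _ _).trans (mul_le_mul_of_nonneg_right (ha k) (norm_nonneg b))
    _ = ‖((N.choose k * k ! : ℕ) : K)‖ * (‖a‖ * ‖b‖) := by
        rw [Nat.cast_mul, norm_mul]
        ring

/-- The Leibniz formula for `d^k (a b)` expresses `b d^k a` through `d^k (a b)` and lower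
derivatives of `a`. -/
theorem IsTaylorBounded.of_mul_right {L : Type*} [NormedField L] [IsUltrametricDist L]
    [NormedAlgebra K L] {d : L →+ L} (hd : IsDerivationAlong d d) {a b : L} (hb0 : b ≠ 0)
    (hab : IsTaylorBounded K d (a * b)) (hb : IsTaylorBounded K d b) : IsTaylorBounded K d a := by
  intro k
  induction k using Nat.strong_induction_on with
  | _ k ih =>
    have leading_term : d^[k] a * b = d^[k] (a * b) -
        ∑ ij ∈ (antidiagonal k).erase (k, 0), k.choose ij.1 • (d^[ij.1] a * d^[ij.2] b) := by
      rw [hd.iterate_mul, ← Finset.add_sum_erase _ _ (show (k, 0) ∈ antidiagonal k by simp)]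
      simp
    have lower_terms : ∀ ij ∈ (antidiagonal k).erase (k, 0),
        ‖k.choose ij.1 • (d^[ij.1] a * d^[ij.2] b)‖ ≤ ‖(k ! : K)‖ * (‖a‖ * ‖b‖) := by
      rintro ⟨i, j⟩ hij
      rw [Finset.mem_erase, mem_antidiagonal] at hij
      obtain ⟨hne, rfl⟩ := hij
      have hi : i < i + j := by grind
      rw [norm_nsmul_eq_natCast (K := K), norm_mul, Nat.choose_symm_add,
        ← Nat.add_choose_mul_factorial_mul_factorial, Nat.cast_mul, Nat.cast_mul, norm_mul,
        norm_mul]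
      calc _ ≤ ‖((i + j).choose j : K)‖ * ((‖(i ! : K)‖ * ‖a‖) * (‖(j ! : K)‖ * ‖b‖)) := by
            gcongr
            exacts [ih i hi, hb j]
        _ = _ := by ring
    refine le_of_mul_le_mul_right ?_ (norm_pos_iff.mpr hb0)
    rw [← norm_mul, leading_term, mul_assoc, sub_eq_add_neg]
    refine (IsUltrametricDist.norm_add_le_max _ _).trans (max_le ?_ ?_)
    · rw [← norm_mul]
      exact hab k
    · rw [norm_neg]
      exact IsUltrametricDist.norm_sum_le_of_forall_le_of_nonneg (by positivity) lower_terms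

end TaylorBound

section Contraction

theorem norm_iterate_le_pow_mul {A : Type*} [Norm A] {f : A → A} {θ : ℝ} (hθ : 0 ≤ θ)
    (hf : ∀ a, ‖f a‖ ≤ θ * ‖a‖) (m : ℕ) (a : A) : ‖f^[m] a‖ ≤ θ ^ m * ‖a‖ := by
  induction m with
  | zero => simp
  | succ m ih =>
    rw [Function.iterate_succ_apply', pow_succ', mul_assoc]
    exact (hf _).trans (mul_le_mul_of_nonneg_left ih hθ)

theorem dvd_choose_mul_factorial {m N k : ℕ} (hm : m ∣ N) (hk : k ≠ 0) :
    m ∣ N.choose k * k ! := by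
  obtain ⟨k, rfl⟩ := Nat.exists_eq_succ_of_ne_zero hk
  rw [mul_comm, ← Nat.descFactorial_eq_factorial_mul_choose]
  cases N with
  | zero => simp
  | succ N => exact Nat.succ_descFactorial_succ N k ▸ hm.mul_right _

variable {K : Type*} [NormedField K]

theorem norm_natCast_le_of_dvd [IsUltrametricDist K] {m N : ℕ} (h : m ∣ N) :
    ‖(N : K)‖ ≤ ‖(m : K)‖ := by
  obtain ⟨l, rfl⟩ := h
  rw [Nat.cast_mul, norm_mul]
  exact mul_le_of_le_one_right (norm_nonneg _) (IsUltrametricDist.norm_natCast_le_one K l)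

variable {A : Type*} [SeminormedRing A] [IsUltrametricDist A] {d : A →+ A} {G : A}

theorem norm_connection_le (hdK : ∀ a, IsTaylorBounded K d a) (hG : ‖G‖ ≤ 1) (a : A) :
    ‖connection d G a‖ ≤ ‖a‖ :=
  (IsUltrametricDist.norm_add_le_max _ _).trans <| max_le
    ((norm_mul_le _ _).trans (mul_le_of_le_one_right (norm_nonneg a) hG)) (hdK a).norm_apply_le

theorem norm_connection_iterate_le (hdK : ∀ a, IsTaylorBounded K d a) (hG : ‖G‖ ≤ 1) (s : ℕ)
    (a : A) : ‖(connection d G)^[s] a‖ ≤ ‖a‖ := by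
  simpa using norm_iterate_le_pow_mul zero_le_one
    (fun a => by simpa using norm_connection_le hdK hG a) s a

variable [IsUltrametricDist K] [NormedAlgebra K A]

/-- In `∇^N (a 1) = ∑ (N choose k) d^k a · ∇^(N-k) 1` every term with `k > 0` gains the factor
`N (N - 1) ⋯ (N - k + 1)`, a multiple of `m`, from `(N choose k) k!`. -/
theorem norm_connection_iterate_le_max_mul (hd : IsDerivationAlong d d)
    (hdK : ∀ a, IsTaylorBounded K d a) (hG : ‖G‖ ≤ 1) (h1 : ‖(1 : A)‖ ≤ 1) {m N : ℕ}
    (hm : m ∣ N) (a : A) :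
    ‖(connection d G)^[N] a‖ ≤ max ‖(m : K)‖ ‖(connection d G)^[N] 1‖ * ‖a‖ := by
  set ε := max ‖(m : K)‖ ‖(connection d G)^[N] 1‖
  rw [← mul_one a, (isDerivationAlong_connection hd G).iterate_mul, mul_one]
  refine IsUltrametricDist.norm_sum_le_of_forall_le_of_nonneg (by positivity) ?_
  rintro ⟨k, l⟩ hkl
  obtain rfl : k + l = N := mem_antidiagonal.mp hkl
  refine ((hdK a).norm_choose_nsmul_mul_le _ _ _).trans ?_
  rcases eq_or_ne k 0 with rfl | hk
  · have hε : ‖(connection d G)^[l] 1‖ ≤ ε := by simp [ε]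
    simpa [mul_comm] using mul_le_mul_of_nonneg_right hε (norm_nonneg a)
  · have hε : ‖(((k + l).choose k * k ! : ℕ) : K)‖ ≤ ε :=
      (norm_natCast_le_of_dvd (dvd_choose_mul_factorial hm hk)).trans (le_max_left _ _)
    have hl : ‖(connection d G)^[l] 1‖ ≤ 1 := (norm_connection_iterate_le hdK hG l 1).trans h1
    gcongr
    exact mul_le_of_le_one_right (norm_nonneg a) hl

theorem norm_connection_iterate_le_pow_mul (hd : IsDerivationAlong d d)
    (hdK : ∀ a, IsTaylorBounded K d a) (hG : ‖G‖ ≤ 1) (h1 : ‖(1 : A)‖ ≤ 1) {m N : ℕ}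
    (hm : m ∣ N) (s : ℕ) (a : A) :
    ‖(connection d G)^[s] a‖ ≤
      max ‖(m : K)‖ ‖(connection d G)^[N] 1‖ ^ (s / N) * ‖a‖ := by
  conv_lhs => rw [← Nat.div_add_mod s N, Function.iterate_add_apply, Function.iterate_mul]
  refine (norm_iterate_le_pow_mul (by positivity)
    (norm_connection_iterate_le_max_mul hd hdK hG h1 hm) _ _).trans ?_
  gcongr
  exact norm_connection_iterate_le hdK hG _ a

end Contraction

section FactorialNorm

variable {K : Type*} [NormedField K] [IsUltrametricDist K]

theorem norm_natCast_eq_one_of_coprime {m l : ℕ} (hm : ‖(m : K)‖ < 1) (h : m.Coprime l) :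
    ‖(l : K)‖ = 1 := by
  refine le_antisymm (IsUltrametricDist.norm_natCast_le_one K l) (le_of_not_gt fun hl => ?_)
  obtain ⟨x, y, hxy⟩ := Nat.isCoprime_iff_coprime.mpr h
  have norm_intCast_mul_lt {z : ℤ} {k : ℕ} (hk : ‖(k : K)‖ < 1) : ‖(z * k : K)‖ < 1 := by
    rw [norm_mul]
    exact mul_lt_one_of_nonneg_of_lt_one_right
      (IsUltrametricDist.norm_intCast_le_one K z) (norm_nonneg _) hk
  have one_eq : (x * m + y * l : K) = 1 := by exact_mod_cast congrArg (Int.cast : ℤ → K) hxy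
  refine lt_irrefl (1 : ℝ) ?_
  calc (1 : ℝ) = ‖(x * m + y * l : K)‖ := by rw [one_eq, norm_one]
    _ ≤ max ‖(x * m : K)‖ ‖(y * l : K)‖ := IsUltrametricDist.norm_add_le_max _ _
    _ < 1 := max_lt (norm_intCast_mul_lt hm) (norm_intCast_mul_lt hl)

variable {p : ℕ} [hp : Fact p.Prime]

theorem norm_natCast_eq_pow_padicValNat (hpK : ‖(p : K)‖ < 1) {m : ℕ} (hm : m ≠ 0) :
    ‖(m : K)‖ = ‖(p : K)‖ ^ padicValNat p m := by
  obtain ⟨e, l, hl, rfl⟩ := Nat.exists_eq_pow_mul_and_not_dvd hm p hp.out.ne_one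
  have hl0 : l ≠ 0 := right_ne_zero_of_mul hm
  rw [Nat.cast_mul, norm_mul, Nat.cast_pow, norm_pow,
    norm_natCast_eq_one_of_coprime hpK (hp.out.coprime_iff_not_dvd.mpr hl), mul_one,
    padicValNat.mul (pow_ne_zero _ hp.out.ne_zero) hl0, padicValNat.prime_pow,
    padicValNat.eq_zero_of_not_dvd hl, add_zero]

variable {c : ℝ} (hpK : ‖(p : K)‖ < 1) (hc : c ^ (p - 1) = ‖(p : K)‖)

include hpK hc

theorem norm_factorial_eq_pow (s : ℕ) : ‖(s ! : K)‖ = c ^ (s - (p.digits s).sum) := by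
  rw [norm_natCast_eq_pow_padicValNat hpK s.factorial_ne_zero, ← hc, ← pow_mul,
    sub_one_mul_padicValNat_factorial]

theorem norm_factorial_prime_pow (k : ℕ) : ‖((p ^ k)! : K)‖ = c ^ (p ^ k - 1) := by
  have digits_eq : p.digits (p ^ k) = List.replicate k 0 ++ [1] := by
    simpa [Nat.digits_of_lt p 1 one_ne_zero hp.out.one_lt] using
      Nat.digits_base_pow_mul (k := k) hp.out.one_lt one_pos
  rw [norm_factorial_eq_pow hpK hc, digits_eq]
  simp

theorem pow_le_norm_factorial (hc0 : 0 ≤ c) (s : ℕ) : c ^ s ≤ ‖(s ! : K)‖ := by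
  have hc1 : c ≤ 1 := by
    by_contra! h
    exact absurd (one_le_pow₀ h.le) (hc ▸ hpK).not_ge
  rw [norm_factorial_eq_pow hpK hc]
  exact pow_le_pow_of_le_one hc0 hc1 (Nat.sub_le _ _)

/-- The bound at `s = p ^ k` reads `u (p ^ k) ≤ (C / c) (c / r) ^ (p ^ k)`. -/
theorem exists_prime_pow_lt_one_of_mul_pow_le (hc0 : 0 < c) {u : ℕ → ℝ} {r C : ℝ} (hr : c < r)
    (hu : ∀ s, u s * r ^ s ≤ C * ‖(s ! : K)‖) : ∃ k ≠ 0, u (p ^ k) < 1 := by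
  have hr0 : 0 < r := hc0.trans hr
  have tendsto_zero : Tendsto (fun k : ℕ => C / c * (c / r) ^ p ^ k) atTop (𝓝 0) := by
    simpa using ((tendsto_pow_atTop_nhds_zero_of_lt_one (by positivity)
      ((div_lt_one hr0).mpr hr)).comp
        (tendsto_pow_atTop_atTop_of_one_lt hp.out.one_lt)).const_mul (C / c)
  obtain ⟨k, hk, hk0⟩ := ((tendsto_zero.eventually_lt_const one_pos).and
    (eventually_ne_atTop 0)).exists
  refine ⟨k, hk0, lt_of_le_of_lt ?_ hk⟩
  have hpow : c ^ p ^ k = c ^ (p ^ k - 1) * c := by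
    rw [← pow_succ, Nat.sub_add_cancel (pow_pos hp.out.pos k)]
  calc u (p ^ k) ≤ C * c ^ (p ^ k - 1) / r ^ p ^ k := by
        rw [le_div_iff₀ (by positivity), ← norm_factorial_prime_pow hpK hc]
        exact hu _
    _ = C / c * (c / r) ^ p ^ k := by
        rw [div_pow, hpow]
        field_simp

end FactorialNorm

section Radius

theorem exists_one_lt_pow_div_mul_pow_le {θ : ℝ} (hθ0 : 0 < θ) (hθ1 : θ < 1) {N : ℕ}
    (hN : N ≠ 0) : ∃ ρ > 1, ∀ s, θ ^ (s / N) * ρ ^ s ≤ θ⁻¹ := by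
  obtain ⟨ρ, hρ1, hρN⟩ : ∃ ρ : ℝ, 1 < ρ ∧ ρ ^ N = θ⁻¹ :=
    ⟨θ⁻¹ ^ (N⁻¹ : ℝ), Real.one_lt_rpow ((one_lt_inv₀ hθ0).mpr hθ1) (by positivity),
      Real.rpow_inv_natCast_pow (by positivity) hN⟩
  refine ⟨ρ, hρ1, fun s => ?_⟩
  calc θ ^ (s / N) * ρ ^ s = θ ^ (s / N) * ((ρ ^ N) ^ (s / N) * ρ ^ (s % N)) := by
        rw [← pow_mul, ← pow_add, Nat.div_add_mod]
    _ = ρ ^ (s % N) := by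
        rw [hρN, ← mul_assoc, ← mul_pow, mul_inv_cancel₀ hθ0.ne', one_pow, one_mul]
    _ ≤ ρ ^ N := pow_le_pow_right₀ hρ1.le (Nat.mod_lt s hN.bot_lt).le
    _ = θ⁻¹ := hρN

variable {K : Type*} [NormedField K] [IsUltrametricDist K] {A : Type*} [SeminormedRing A]
  [NormedAlgebra K A] [IsUltrametricDist A] {d : A →+ A} {G : A} {p : ℕ} [hp : Fact p.Prime] {c : ℝ}

/-- Dwork's criterion: the iterates of a connection contract if and only if the Taylor series with
coefficients `∇^s 1 / s!` converges beyond the radius `c = |p|^(1/(p-1))` of the exponential. -/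
theorem exists_norm_connection_iterate_lt_one_iff (hd : IsDerivationAlong d d)
    (hdK : ∀ a, IsTaylorBounded K d a) (hG : ‖G‖ ≤ 1) (h1 : ‖(1 : A)‖ ≤ 1)
    (hpK : ‖(p : K)‖ < 1) (hc0 : 0 < c) (hc : c ^ (p - 1) = ‖(p : K)‖) :
    (∃ k ≠ 0, ‖(connection d G)^[p * k] 1‖ < 1) ↔
      ∃ r > c, ∃ C, ∀ s, ‖(connection d G)^[s] 1‖ * r ^ s ≤ C * ‖(s ! : K)‖ := by
  constructor
  · rintro ⟨k, hk, hk1⟩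
    set θ := max ‖(p : K)‖ ‖(connection d G)^[p * k] 1‖
    have hθ0 : 0 < θ := lt_max_of_lt_left (hc ▸ pow_pos hc0 _)
    obtain ⟨ρ, hρ1, hρ⟩ := exists_one_lt_pow_div_mul_pow_le hθ0 (max_lt hpK hk1)
      (mul_ne_zero hp.out.ne_zero hk)
    have decay (s : ℕ) : ‖(connection d G)^[s] 1‖ ≤ θ ^ (s / (p * k)) :=
      (norm_connection_iterate_le_pow_mul hd hdK hG h1 (dvd_mul_right p k) s 1).trans
        (mul_le_of_le_one_right (by positivity) h1)
    refine ⟨c * ρ, lt_mul_of_one_lt_right hc0 hρ1, θ⁻¹, fun s => ?_⟩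
    calc ‖(connection d G)^[s] 1‖ * (c * ρ) ^ s ≤ θ ^ (s / (p * k)) * (c * ρ) ^ s := by
          gcongr
          exact decay s
      _ = θ ^ (s / (p * k)) * ρ ^ s * c ^ s := by ring
      _ ≤ θ⁻¹ * ‖(s ! : K)‖ :=
          mul_le_mul (hρ s) (pow_le_norm_factorial hpK hc hc0.le s) (by positivity) (by positivity)
  · rintro ⟨r, hr, C, hC⟩
    obtain ⟨k, hk, hk1⟩ := exists_prime_pow_lt_one_of_mul_pow_le hpK hc hc0 hr hC
    refine ⟨p ^ (k - 1), pow_ne_zero _ hp.out.ne_zero, ?_⟩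
    rwa [← pow_succ', Nat.sub_add_cancel (Nat.one_le_iff_ne_zero.mpr hk)]

end Radius

section RationalFunctions

variable {F : Type*} [Field F]

theorem exists_eq_div (f : RatFunc F) :
    ∃ P Q : F[X], Q ≠ 0 ∧ f = algebraMap F[X] (RatFunc F) P / algebraMap F[X] (RatFunc F) Q :=
  ⟨f.num, f.denom, f.denom_ne_zero, f.num_div_denom.symm⟩

theorem mul_algebraMap_denom (f : RatFunc F) :
    f * algebraMap F[X] (RatFunc F) f.denom = algebraMap F[X] (RatFunc F) f.num := by
  rw [← eq_div_iff (RatFunc.algebraMap_ne_zero f.denom_ne_zero), RatFunc.num_div_denom]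

theorem ratDeriv_add (f g : RatFunc F) : ratDeriv (f + g) = ratDeriv f + ratDeriv g := by
  obtain ⟨P, Q, hQ, rfl⟩ := exists_eq_div f
  obtain ⟨R, S, hS, rfl⟩ := exists_eq_div g
  have hQ' : algebraMap F[X] (RatFunc F) Q ≠ 0 := RatFunc.algebraMap_ne_zero hQ
  have hS' : algebraMap F[X] (RatFunc F) S ≠ 0 := RatFunc.algebraMap_ne_zero hS
  rw [div_add_div _ _ hQ' hS', ← map_mul, ← map_mul, ← map_mul, ← map_add,
    ratDeriv_div _ _ hQ, ratDeriv_div _ _ hS, ratDeriv_div _ _ (mul_ne_zero hQ hS)]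
  simp only [derivative_mul, map_add, map_sub, map_mul, map_pow]
  field_simp
  ring

theorem ratDeriv_mul (f g : RatFunc F) : ratDeriv (f * g) = ratDeriv f * g + f * ratDeriv g := by
  obtain ⟨P, Q, hQ, rfl⟩ := exists_eq_div f
  obtain ⟨R, S, hS, rfl⟩ := exists_eq_div g
  have hQ' : algebraMap F[X] (RatFunc F) Q ≠ 0 := RatFunc.algebraMap_ne_zero hQ
  have hS' : algebraMap F[X] (RatFunc F) S ≠ 0 := RatFunc.algebraMap_ne_zero hS
  rw [div_mul_div_comm, ← map_mul, ← map_mul,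
    ratDeriv_div _ _ hQ, ratDeriv_div _ _ hS, ratDeriv_div _ _ (mul_ne_zero hQ hS)]
  simp only [derivative_mul, map_add, map_sub, map_mul, map_pow]
  field_simp
  ring

theorem ratDeriv_algebraMap (P : F[X]) :
    ratDeriv (algebraMap F[X] (RatFunc F) P) = algebraMap F[X] (RatFunc F) (derivative P) := by
  simpa using ratDeriv_div P 1 one_ne_zero

/-- The derivative `d/dz` as an additive endomorphism of `F(z)`. -/
def ratDerivHom : RatFunc F →+ RatFunc F := AddMonoidHom.mk' ratDeriv ratDeriv_add

theorem isDerivationAlong_ratDerivHom :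
    IsDerivationAlong (ratDerivHom (F := F)) ratDerivHom := ratDeriv_mul

theorem ratDerivHom_iterate_algebraMap (P : F[X]) (k : ℕ) :
    ratDerivHom^[k] (algebraMap F[X] (RatFunc F) P) =
      algebraMap F[X] (RatFunc F) (derivative^[k] P) :=
  ((Function.Semiconj.iterate_right (f := algebraMap F[X] (RatFunc F))
    (fun P => (ratDeriv_algebraMap P).symm) k).eq P).symm

theorem iterMatrix_eq_connection_iterate {n : ℕ} (G : Matrix (Fin n) (Fin n) (RatFunc F))
    (s : ℕ) : iterMatrix G s = (connection ratDerivHom.mapMatrix G)^[s] 1 := by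
  induction s with
  | zero => rfl
  | succ s ih => rw [Function.iterate_succ_apply', ← ih]; rfl

end RationalFunctions

section Matrix

variable {R m : Type*}

theorem mapMatrix_iterate_apply [AddMonoid R] (d : R →+ R) (k : ℕ) (M : Matrix m m R) (i j : m) :
    d.mapMatrix^[k] M i j = d^[k] (M i j) :=
  (Function.Semiconj.iterate_right (f := fun N : Matrix m m R => N i j) (fun _ => rfl) k).eq M

variable [Fintype m]

theorem IsDerivationAlong.mapMatrix [DecidableEq m] [Ring R] {d D : R →+ R}
    (h : IsDerivationAlong d D) :
    IsDerivationAlong (d.mapMatrix : Matrix m m R →+ Matrix m m R) D.mapMatrix := by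
  intro M N
  ext i j
  simp only [AddMonoidHom.mapMatrix_apply, Matrix.map_apply, Matrix.add_apply, Matrix.mul_apply,
    map_sum, h _ _, Finset.sum_add_distrib]

end Matrix

section CharP

variable {F : Type*} [Field F] (p : ℕ) [CharP F p]

variable (F) in
theorem ratFunc_natCast_char_eq_zero : (p : RatFunc F) = 0 := by
  rw [← map_natCast (algebraMap F (RatFunc F)), CharP.cast_eq_zero, map_zero]

variable [hp : Fact p.Prime]

theorem derivative_iterate_prime_eq_zero (P : F[X]) : derivative^[p] P = 0 := by
  have factorial_eq_zero : (p ! : F) = 0 :=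
    (CharP.cast_eq_zero_iff F p _).mpr (Nat.dvd_factorial hp.out.pos le_rfl)
  rw [← factorial_smul_hasseDeriv, LinearMap.smul_apply, ← Nat.cast_smul_eq_nsmul F,
    factorial_eq_zero, zero_smul]

theorem ratDerivHom_iterate_prime_eq_zero (f : RatFunc F) : ratDerivHom^[p] f = 0 := by
  have h := isDerivationAlong_ratDerivHom.iterate_prime_mul hp.out
    (ratFunc_natCast_char_eq_zero F p) f (algebraMap F[X] (RatFunc F) f.denom)
  rw [mul_algebraMap_denom, ratDerivHom_iterate_algebraMap, ratDerivHom_iterate_algebraMap,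
    derivative_iterate_prime_eq_zero, derivative_iterate_prime_eq_zero, map_zero, mul_zero,
    add_zero] at h
  exact (mul_eq_zero.mp h.symm).resolve_right (RatFunc.algebraMap_ne_zero f.denom_ne_zero)

theorem iterMatrix_prime_mul {n : ℕ} (G : Matrix (Fin n) (Fin n) (RatFunc F)) (k : ℕ) :
    iterMatrix G (p * k) = iterMatrix G p ^ k := by
  have natCast_eq_zero : (p : Matrix (Fin n) (Fin n) (RatFunc F)) = 0 := by
    rw [← Matrix.diagonal_natCast, ratFunc_natCast_char_eq_zero, Matrix.diagonal_zero]
  rw [iterMatrix_eq_connection_iterate, iterMatrix_eq_connection_iterate]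
  refine connection_iterate_prime_mul_one isDerivationAlong_ratDerivHom.mapMatrix G hp.out
    natCast_eq_zero (fun M => ?_) k
  ext i j
  rw [mapMatrix_iterate_apply, ratDerivHom_iterate_prime_eq_zero, Matrix.zero_apply]

theorem isNilpotentSystem_iff_exists_iterMatrix_eq_zero {n : ℕ}
    (G : Matrix (Fin n) (Fin n) (RatFunc F)) :
    IsNilpotentSystem p G ↔ ∃ k ≠ 0, iterMatrix G (p * k) = 0 := by
  simp only [iterMatrix_prime_mul]
  constructor
  · rintro ⟨k, hk⟩
    exact ⟨k + 1, k.succ_ne_zero, pow_eq_zero_of_le k.le_succ hk⟩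
  · rintro ⟨k, -, hk⟩
    exact ⟨k, hk⟩

end CharP

section MatrixNorm

variable {m R : Type*} [Fintype m] [DecidableEq m] [SeminormedRing R] [IsUltrametricDist R]

/-- Square matrices over an ultrametric ring, with the sup norm: it is submultiplicative because the
norm of a sum is at most the largest norm of a term. -/
abbrev supNormMatrixRing : SeminormedRing (Matrix m m R) :=
  { Matrix.seminormedAddCommGroup, (inferInstance : Ring (Matrix m m R)) with
    norm_mul_le := fun M N => by
      let _ : SeminormedAddCommGroup (Matrix m m R) := Matrix.seminormedAddCommGroup
      refine (Matrix.norm_le_iff (by positivity)).mpr fun i j => ?_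
      rw [Matrix.mul_apply]
      refine IsUltrametricDist.norm_sum_le_of_forall_le_of_nonneg (by positivity) fun k _ => ?_
      exact (norm_mul_le _ _).trans (mul_le_mul (Matrix.norm_entry_le_entrywise_sup_norm M)
        (Matrix.norm_entry_le_entrywise_sup_norm N) (norm_nonneg _) (norm_nonneg _)) }

attribute [local instance] supNormMatrixRing

variable {K : Type*} [NormedField K]

/-- The sup norm on square matrices is compatible with scalars. -/
abbrev supNormMatrixAlgebra [NormedAlgebra K R] : NormedAlgebra K (Matrix m m R) :=
  { (inferInstance : Algebra K (Matrix m m R)) with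
    norm_smul_le := fun c M => (Matrix.normedSpace (α := R)).norm_smul_le c M }

theorem isUltrametricDist_matrix : IsUltrametricDist (Matrix m m R) :=
  inferInstanceAs (IsUltrametricDist (m → m → R))

theorem norm_one_matrix_le [NormOneClass R] : ‖(1 : Matrix m m R)‖ ≤ 1 := by
  refine (Matrix.norm_le_iff zero_le_one).mpr fun i j => ?_
  rw [Matrix.one_apply]
  split_ifs <;> simp

theorem IsTaylorBounded.mapMatrix {d : R →+ R} (h : ∀ a, IsTaylorBounded K d a)
    (M : Matrix m m R) : IsTaylorBounded K d.mapMatrix M := fun k => by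
  refine (Matrix.norm_le_iff (by positivity)).mpr fun i j => ?_
  rw [mapMatrix_iterate_apply]
  refine (h _ k).trans ?_
  gcongr
  exact Matrix.norm_entry_le_entrywise_sup_norm M

end MatrixNorm

section GaussNorm

variable {K : Type*} [NormedField K] [IsUltrametricDist K]

theorem ratGaussNorm_algebraMap (P : K[X]) :
    ratGaussNorm (algebraMap K[X] (RatFunc K) P) = P.supNorm := by
  have := ratGaussNorm_div P 1 one_ne_zero
  rwa [map_one, div_one, ← C_1, supNorm_C, norm_one, div_one] at this

attribute [local instance] gaussField

theorem isUltrametricDist_ratFunc : IsUltrametricDist (RatFunc K) :=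
  IsUltrametricDist.isUltrametricDist_of_forall_norm_add_le_max_norm (ratGaussNorm_add K)

variable (K) in
/-- The Gauss norm extends the norm of `K`. -/
abbrev gaussAlgebra : NormedAlgebra K (RatFunc K) :=
  { (inferInstance : Algebra K (RatFunc K)) with
    norm_smul_le := fun c f => by
      have norm_C : ‖algebraMap K (RatFunc K) c‖ = ‖c‖ := by
        rw [IsScalarTower.algebraMap_apply K K[X] (RatFunc K)]
        exact (ratGaussNorm_algebraMap (C c)).trans supNorm_C
      rw [Algebra.smul_def, norm_mul, norm_C] }

attribute [local instance] gaussAlgebra isUltrametricDist_ratFunc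

theorem supNorm_iterate_derivative_le (P : K[X]) (k : ℕ) :
    (derivative^[k] P).supNorm ≤ ‖(k ! : K)‖ * P.supNorm := by
  obtain ⟨i, hi⟩ := (derivative^[k] P).exists_eq_supNorm
  rw [hi, coeff_iterate_derivative, Nat.descFactorial_eq_factorial_mul_choose, nsmul_eq_mul,
    Nat.cast_mul, norm_mul, norm_mul, mul_assoc]
  gcongr
  exact (mul_le_of_le_one_left (norm_nonneg _) (IsUltrametricDist.norm_natCast_le_one K _)).trans
    (P.le_supNorm _)

theorem isTaylorBounded_algebraMap (P : K[X]) :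
    IsTaylorBounded K ratDerivHom (algebraMap K[X] (RatFunc K) P) := fun k => by
  rw [ratDerivHom_iterate_algebraMap]
  have h := supNorm_iterate_derivative_le P k
  rw [← ratGaussNorm_algebraMap, ← ratGaussNorm_algebraMap] at h
  exact h

theorem isTaylorBounded_ratDerivHom (f : RatFunc K) : IsTaylorBounded K ratDerivHom f :=
  .of_mul_right isDerivationAlong_ratDerivHom (RatFunc.algebraMap_ne_zero f.denom_ne_zero)
    (by rw [mul_algebraMap_denom]; exact isTaylorBounded_algebraMap _)
    (isTaylorBounded_algebraMap _)

end GaussNorm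

section Reduction

variable {K : Type*} [NormedField K] [IsUltrametricDist K]

theorem mem_valRing_iff {x : K} : x ∈ valRing K ↔ ‖x‖ ≤ 1 := by
  rw [Valuation.mem_valuationSubring_iff, NormedField.valuation_apply, ← NNReal.coe_le_coe,
    coe_nnnorm, NNReal.coe_one]

theorem residue_eq_zero_iff (x : valRing K) :
    IsLocalRing.residue (valRing K) x = 0 ↔ ‖(x : K)‖ < 1 := by
  rw [IsLocalRing.residue_eq_zero_iff, ValuationSubring.valuation_lt_one_iff,
    ← (Valuation.isEquiv_valuation_valuationSubring _).lt_one_iff_lt_one,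
    NormedField.valuation_apply, ← NNReal.coe_lt_coe, coe_nnnorm, NNReal.coe_one]

variable (K) in
theorem norm_natCast_char_lt_one (p : ℕ) [CharP (residueField K) p] : ‖(p : K)‖ < 1 := by
  have := (residue_eq_zero_iff (K := K) p).mp (by rw [map_natCast, CharP.cast_eq_zero])
  simpa using this

theorem supNorm_map_subtype_le_one (P : (valRing K)[X]) :
    (P.map (valRing K).subtype).supNorm ≤ 1 := by
  obtain ⟨i, hi⟩ := (P.map (valRing K).subtype).exists_eq_supNorm
  rw [hi, coeff_map]
  exact mem_valRing_iff.mp (P.coeff i).2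

theorem map_residue_eq_zero_iff (P : (valRing K)[X]) :
    P.map (IsLocalRing.residue (valRing K)) = 0 ↔ (P.map (valRing K).subtype).supNorm < 1 := by
  simp only [Polynomial.ext_iff, coeff_map, coeff_zero, residue_eq_zero_iff]
  constructor
  · intro h
    obtain ⟨i, hi⟩ := (P.map (valRing K).subtype).exists_eq_supNorm
    rw [hi, coeff_map]
    exact h i
  · intro h i
    have norm_coeff_le := (P.map (valRing K).subtype).le_supNorm i
    rw [coeff_map] at norm_coeff_le
    exact norm_coeff_le.trans_lt h

namespace Represents

variable {f g : RatFunc K} {P Q R S : (valRing K)[X]}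

theorem supNorm_denom (h : Represents f P Q) : (Q.map (valRing K).subtype).supNorm = 1 :=
  le_antisymm (supNorm_map_subtype_le_one Q) (not_lt.mp (mt (map_residue_eq_zero_iff Q).mpr h.1))

theorem denom_ne_zero (h : Represents f P Q) : Q.map (valRing K).subtype ≠ 0 := by
  rw [Ne, ← supNorm_eq_zero_iff, h.supNorm_denom]
  exact one_ne_zero

theorem ratGaussNorm_eq (h : Represents f P Q) :
    ratGaussNorm f = (P.map (valRing K).subtype).supNorm := by
  rw [h.2, ratGaussNorm_div _ _ h.denom_ne_zero, h.supNorm_denom, div_one]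

theorem add (h : Represents f P Q) (h' : Represents g R S) :
    Represents (f + g) (P * S + Q * R) (Q * S) := by
  refine ⟨by rw [Polynomial.map_mul]; exact mul_ne_zero h.1 h'.1, ?_⟩
  rw [h.2, h'.2, div_add_div _ _ (RatFunc.algebraMap_ne_zero h.denom_ne_zero)
    (RatFunc.algebraMap_ne_zero h'.denom_ne_zero)]
  simp only [Polynomial.map_add, Polynomial.map_mul, map_add, map_mul]

theorem mul (h : Represents f P Q) (h' : Represents g R S) :
    Represents (f * g) (P * R) (Q * S) := by
  refine ⟨by rw [Polynomial.map_mul]; exact mul_ne_zero h.1 h'.1, ?_⟩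
  rw [h.2, h'.2, div_mul_div_comm]
  simp only [Polynomial.map_mul, map_mul]

theorem ratDeriv (h : Represents f P Q) :
    Represents (ratDeriv f) (derivative P * Q - P * derivative Q) (Q ^ 2) := by
  refine ⟨by rw [Polynomial.map_pow]; exact pow_ne_zero 2 h.1, ?_⟩
  rw [h.2, ratDeriv_div _ _ h.denom_ne_zero]
  simp only [Polynomial.map_sub, Polynomial.map_mul, Polynomial.map_pow, derivative_map]

end Represents

section ratReduction

variable {f g : RatFunc K}

theorem ratReduction_eq_zero_iff (hf : ratGaussNorm f ≤ 1) :
    ratReduction f = 0 ↔ ratGaussNorm f < 1 := by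
  obtain ⟨P, Q, h⟩ := exists_represents hf
  rw [ratReduction_eq h, h.ratGaussNorm_eq, ← map_residue_eq_zero_iff, reducedFraction,
    div_eq_zero_iff, or_iff_left (RatFunc.algebraMap_ne_zero h.1),
    map_eq_zero_iff _ (RatFunc.algebraMap_injective _)]

theorem ratReduction_zero : ratReduction (0 : RatFunc K) = 0 :=
  (ratReduction_eq_zero_iff (by simp [ratGaussNorm_zero])).mpr (by simp [ratGaussNorm_zero])

theorem ratReduction_one : ratReduction (1 : RatFunc K) = 1 := by
  have h : Represents (1 : RatFunc K) 1 1 := ⟨by simp, by simp⟩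
  rw [ratReduction_eq h, reducedFraction, div_self (RatFunc.algebraMap_ne_zero h.1)]

theorem ratReduction_add (hf : ratGaussNorm f ≤ 1) (hg : ratGaussNorm g ≤ 1) :
    ratReduction (f + g) = ratReduction f + ratReduction g := by
  obtain ⟨P, Q, h⟩ := exists_represents hf
  obtain ⟨R, S, h'⟩ := exists_represents hg
  rw [ratReduction_eq (h.add h'), ratReduction_eq h, ratReduction_eq h', reducedFraction,
    reducedFraction, reducedFraction, div_add_div _ _ (RatFunc.algebraMap_ne_zero h.1)
      (RatFunc.algebraMap_ne_zero h'.1)]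
  simp only [Polynomial.map_add, Polynomial.map_mul, map_add, map_mul]

theorem ratReduction_mul (hf : ratGaussNorm f ≤ 1) (hg : ratGaussNorm g ≤ 1) :
    ratReduction (f * g) = ratReduction f * ratReduction g := by
  obtain ⟨P, Q, h⟩ := exists_represents hf
  obtain ⟨R, S, h'⟩ := exists_represents hg
  rw [ratReduction_eq (h.mul h'), ratReduction_eq h, ratReduction_eq h', reducedFraction,
    reducedFraction, reducedFraction, div_mul_div_comm]
  simp only [Polynomial.map_mul, map_mul]

theorem ratReduction_ratDeriv (hf : ratGaussNorm f ≤ 1) :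
    ratReduction (ratDeriv f) = ratDeriv (ratReduction f) := by
  obtain ⟨P, Q, h⟩ := exists_represents hf
  rw [ratReduction_eq h.ratDeriv, ratReduction_eq h, reducedFraction, reducedFraction,
    ratDeriv_div _ _ h.1]
  simp only [Polynomial.map_sub, Polynomial.map_mul, Polynomial.map_pow, derivative_map]

end ratReduction

section matrixReduction

attribute [local instance] gaussField gaussAlgebra isUltrametricDist_ratFunc supNormMatrixRing
  supNormMatrixAlgebra isUltrametricDist_matrix

theorem ratReduction_sum {ι : Type*} (s : Finset ι) {f : ι → RatFunc K}
    (h : ∀ i, ratGaussNorm (f i) ≤ 1) :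
    ratReduction (∑ i ∈ s, f i) = ∑ i ∈ s, ratReduction (f i) := by
  classical
  induction s using Finset.induction_on with
  | empty => simp [ratReduction_zero]
  | insert a s ha ih =>
    have norm_sum_le : ‖∑ i ∈ s, f i‖ ≤ 1 :=
      IsUltrametricDist.norm_sum_le_of_forall_le_of_nonneg zero_le_one fun i _ => h i
    rw [Finset.sum_insert ha, Finset.sum_insert ha, ratReduction_add (h a) norm_sum_le, ih]

variable {n : ℕ} {M N G : Matrix (Fin n) (Fin n) (RatFunc K)}

theorem ratGaussNorm_apply_le_one (hM : ‖M‖ ≤ 1) (i j : Fin n) : ratGaussNorm (M i j) ≤ 1 :=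
  (Matrix.norm_le_iff zero_le_one).mp hM i j

theorem norm_le_one_of_matrixGaussNorm_le_one (hG : matrixGaussNorm G ≤ 1) : ‖G‖ ≤ 1 :=
  (Matrix.norm_le_iff zero_le_one).mpr fun i j =>
    (le_ciSup (f := fun ij : Fin n × Fin n => ratGaussNorm (G ij.1 ij.2))
      (Set.finite_range _).bddAbove (i, j)).trans hG

theorem matrixReduction_eq_zero_iff (hM : ‖M‖ ≤ 1) : matrixReduction M = 0 ↔ ‖M‖ < 1 := by
  rw [← Matrix.ext_iff, Matrix.norm_lt_iff one_pos]
  exact forall₂_congr fun i j => ratReduction_eq_zero_iff (ratGaussNorm_apply_le_one hM i j)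

theorem matrixReduction_one :
    matrixReduction (1 : Matrix (Fin n) (Fin n) (RatFunc K)) = 1 :=
  Matrix.map_one _ ratReduction_zero ratReduction_one

theorem matrixReduction_add (hM : ‖M‖ ≤ 1) (hN : ‖N‖ ≤ 1) :
    matrixReduction (M + N) = matrixReduction M + matrixReduction N := by
  ext i j
  exact ratReduction_add (ratGaussNorm_apply_le_one hM i j) (ratGaussNorm_apply_le_one hN i j)

theorem matrixReduction_mul (hM : ‖M‖ ≤ 1) (hN : ‖N‖ ≤ 1) :
    matrixReduction (M * N) = matrixReduction M * matrixReduction N := by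
  ext i j
  have hM' := ratGaussNorm_apply_le_one hM i
  have hN' := fun k => ratGaussNorm_apply_le_one hN k j
  simp only [matrixReduction, Matrix.map_apply, Matrix.mul_apply]
  rw [ratReduction_sum _ fun k => (ratGaussNorm_mul K _ _).trans_le
    (mul_le_one₀ (hM' k) (ratGaussNorm_nonneg K _) (hN' k))]
  exact Finset.sum_congr rfl fun k _ => ratReduction_mul (hM' k) (hN' k)

theorem matrixReduction_map_ratDeriv (hM : ‖M‖ ≤ 1) :
    matrixReduction (M.map ratDeriv) = (matrixReduction M).map ratDeriv := by
  ext i j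
  exact ratReduction_ratDeriv (ratGaussNorm_apply_le_one hM i j)

theorem norm_iterMatrix_le_one (hG : ‖G‖ ≤ 1) (s : ℕ) : ‖iterMatrix G s‖ ≤ 1 := by
  rw [iterMatrix_eq_connection_iterate]
  exact (norm_connection_iterate_le (.mapMatrix isTaylorBounded_ratDerivHom) hG s 1).trans
    norm_one_matrix_le

theorem matrixReduction_iterMatrix (hG : ‖G‖ ≤ 1) (s : ℕ) :
    matrixReduction (iterMatrix G s) = iterMatrix (matrixReduction G) s := by
  induction s with
  | zero => exact matrixReduction_one
  | succ s ih =>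
    have hs := norm_iterMatrix_le_one hG s
    have hsG : ‖iterMatrix G s * G‖ ≤ 1 :=
      (norm_mul_le _ _).trans (mul_le_one₀ hs (norm_nonneg _) hG)
    have hs' : ‖(iterMatrix G s).map ratDeriv‖ ≤ 1 :=
      (IsTaylorBounded.mapMatrix isTaylorBounded_ratDerivHom _).norm_apply_le.trans hs
    rw [iterMatrix, iterMatrix, matrixReduction_add hsG hs', matrixReduction_mul hs hG,
      matrixReduction_map_ratDeriv hs, ih]

theorem isNilpotentSystem_matrixReduction_iff (p : ℕ) [Fact p.Prime] [CharP (residueField K) p]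
    (hG : ‖G‖ ≤ 1) :
    IsNilpotentSystem p (matrixReduction G) ↔ ∃ k ≠ 0, ‖iterMatrix G (p * k)‖ < 1 := by
  rw [isNilpotentSystem_iff_exists_iterMatrix_eq_zero]
  simp only [← matrixReduction_iterMatrix hG,
    matrixReduction_eq_zero_iff (norm_iterMatrix_le_one hG _)]

end matrixReduction

end Reduction

section GenericRadius

variable {K : Type*} [NormedField K] {Ω : Type*} [NontriviallyNormedField Ω] [NormedAlgebra K Ω]
  {t : Ω} {n : ℕ}

theorem norm_ofScalars_genericSolution (ht : IsGenericPoint K t)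
    (G : Matrix (Fin n) (Fin n) (RatFunc K)) (i j : Fin n) (s : ℕ) :
    ‖FormalMultilinearSeries.ofScalars Ω
        (fun s => PowerSeries.coeff s (genericSolution G t i j)) s‖ =
      ratGaussNorm (iterMatrix G s i j) / ‖(s ! : K)‖ := by
  rw [FormalMultilinearSeries.ofScalars_norm, genericSolution, Matrix.of_apply,
    PowerSeries.coeff_mk, norm_div, ht.2, ← norm_algebraMap' Ω (s ! : K), map_natCast]

variable [CharZero K]

theorem norm_natCast_factorial_pos (s : ℕ) : 0 < ‖(s ! : K)‖ :=
  norm_pos_iff.mpr (Nat.cast_ne_zero.mpr s.factorial_ne_zero)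

variable [IsUltrametricDist K]

attribute [local instance] gaussField gaussAlgebra isUltrametricDist_ratFunc supNormMatrixRing
  supNormMatrixAlgebra isUltrametricDist_matrix

theorem lt_genericRadius_iff (ht : IsGenericPoint K t) (G : Matrix (Fin n) (Fin n) (RatFunc K))
    (c : NNReal) :
    (c : ENNReal) < genericRadius G t ↔
      ∃ r > (c : ℝ), ∃ C, ∀ s, ‖iterMatrix G s‖ * r ^ s ≤ C * ‖(s ! : K)‖ := by
  constructor
  · intro h
    obtain ⟨r, hcr, hr⟩ := ENNReal.lt_iff_exists_nnreal_btwn.mp h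
    have hcr : c < r := ENNReal.coe_lt_coe.mp hcr
    have hr0 : 0 < r := pos_of_gt hcr
    have entry_bound (ij : Fin n × Fin n) : ∃ C, ∀ s,
        ratGaussNorm (iterMatrix G s ij.1 ij.2) / ‖(s ! : K)‖ * r ^ s ≤ C := by
      simp only [← norm_ofScalars_genericSolution ht]
      obtain ⟨C, -, hC⟩ := FormalMultilinearSeries.norm_mul_pow_le_of_lt_radius _
        (hr.trans_le ((iInf_le _ ij.1).trans (iInf_le _ ij.2)))
      exact ⟨C, hC⟩
    choose C hC using entry_bound
    obtain ⟨B, hB⟩ := Finite.exists_le C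
    refine ⟨r, hcr, max B 0, fun s => ?_⟩
    rw [← le_div_iff₀ (by positivity)]
    refine (Matrix.norm_le_iff (by positivity)).mpr fun i j => ?_
    rw [le_div_iff₀ (by positivity), ← div_le_iff₀ (norm_natCast_factorial_pos s),
      ← div_mul_eq_mul_div]
    exact (hC (i, j) s).trans ((hB (i, j)).trans (le_max_left B 0))
  · rintro ⟨r, hcr, C, hC⟩
    lift r to NNReal using c.coe_nonneg.trans hcr.le
    refine (ENNReal.coe_lt_coe.mpr hcr).trans_le (le_iInf fun i => le_iInf fun j => ?_)
    refine FormalMultilinearSeries.le_radius_of_bound _ C fun s => ?_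
    rw [norm_ofScalars_genericSolution ht, div_mul_eq_mul_div,
      div_le_iff₀ (norm_natCast_factorial_pos s)]
    refine le_trans ?_ (hC s)
    gcongr
    exact Matrix.norm_entry_le_entrywise_sup_norm (iterMatrix G s)

theorem isNilpotentSystem_iff_lt_genericRadius (p : ℕ) [hp : Fact p.Prime]
    [CharP (residueField K) p] (ht : IsGenericPoint K t)
    {G : Matrix (Fin n) (Fin n) (RatFunc K)} (hG : matrixGaussNorm G ≤ 1) {c : NNReal}
    (hc : (c : ℝ) ^ (p - 1) = ‖(p : K)‖) :
    IsNilpotentSystem p (matrixReduction G) ↔ (c : ENNReal) < genericRadius G t := by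
  have hG := norm_le_one_of_matrixGaussNorm_le_one hG
  have hc0 : (0 : ℝ) < c := c.coe_nonneg.lt_of_ne fun h => by
    rw [← h, zero_pow (Nat.sub_ne_zero_of_lt hp.out.one_lt), eq_comm, norm_eq_zero] at hc
    exact hp.out.ne_zero (Nat.cast_eq_zero.mp hc)
  rw [isNilpotentSystem_matrixReduction_iff p hG, lt_genericRadius_iff ht]
  simp only [iterMatrix_eq_connection_iterate]
  exact exists_norm_connection_iterate_lt_one_iff isDerivationAlong_ratDerivHom.mapMatrix
    (.mapMatrix isTaylorBounded_ratDerivHom) hG norm_one_matrix_le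
    (norm_natCast_char_lt_one K p) hc0 hc

end GenericRadius

end

end GenericRadius

theorem mainTheorem8_general {K : Type*} [NormedField K] [IsUltrametricDist K] [CharZero K]
    (p : ℕ) [Fact p.Prime] [CharP (GenericRadius.residueField K) p]
    {Ω : Type*} [NontriviallyNormedField Ω] [NormedAlgebra K Ω]
    (t : Ω) (ht : GenericRadius.IsGenericPoint K t)
    (π : Ω) (hπ : π ^ (p - 1) = -(p : Ω))
    {n : ℕ} (G : Matrix (Fin n) (Fin n) (RatFunc K))
    (hG : GenericRadius.matrixGaussNorm G ≤ 1) :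
    (GenericRadius.IsNilpotentSystem p (GenericRadius.matrixReduction G) ↔
      ‖π‖ₑ < GenericRadius.genericRadius G t) ∧
    ‖π‖ = ‖(p : K)‖ ^ (1 / ((p : ℝ) - 1)) ∧
    (‖(p : K)‖ = (p : ℝ)⁻¹ → ‖π‖ = (p : ℝ) ^ (-(1 / ((p : ℝ) - 1)))) := by
  have hp : p.Prime := Fact.out
  have norm_pow_eq : ‖π‖ ^ (p - 1) = ‖(p : K)‖ := by
    rw [← norm_pow, hπ, norm_neg, ← norm_algebraMap' Ω (p : K), map_natCast]
  have norm_eq : ‖π‖ = ‖(p : K)‖ ^ (1 / ((p : ℝ) - 1)) := by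
    rw [← norm_pow_eq, one_div, ← Nat.cast_pred hp.pos,
      Real.pow_rpow_inv_natCast (norm_nonneg π) (Nat.sub_ne_zero_of_lt hp.one_lt)]
  refine ⟨GenericRadius.isNilpotentSystem_iff_lt_genericRadius p ht hG (c := ‖π‖₊) norm_pow_eq,
    norm_eq, fun norm_p => ?_⟩
  rw [norm_eq, norm_p, Real.inv_rpow p.cast_nonneg, Real.rpow_neg p.cast_nonneg]

theorem mainTheorem8 {K : Type*} [NormedField K] [IsUltrametricDist K] [CharZero K]
    (p : ℕ) [Fact p.Prime] [CharP (GenericRadius.residueField K) p]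
    {Ω : Type*} [NontriviallyNormedField Ω] [IsUltrametricDist Ω] [CompleteSpace Ω]
    [IsAlgClosed Ω] [NormedAlgebra K Ω]
    (t : Ω) (ht : GenericRadius.IsGenericPoint K t)
    (π : Ω) (hπ : π ^ (p - 1) = -(p : Ω))
    {n : ℕ} (G : Matrix (Fin n) (Fin n) (RatFunc K))
    (hG : GenericRadius.matrixGaussNorm G ≤ 1) :
    (GenericRadius.IsNilpotentSystem p (GenericRadius.matrixReduction G) ↔
      ‖π‖ₑ < GenericRadius.genericRadius G t) ∧
    ‖π‖ = ‖(p : K)‖ ^ (1 / ((p : ℝ) - 1)) ∧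
    (‖(p : K)‖ = (p : ℝ)⁻¹ → ‖π‖ = (p : ℝ) ^ (-(1 / ((p : ℝ) - 1)))) :=
  mainTheorem8_general p t ht π hπ G hG
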